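/- Let $d>1$ be an integer and $\lambda:=(d-1)/2$. Let $\psi\in\Psi_d$, i.e. $\psi:[0,\pi]\to\mathbb R$ is continuous, $\psi(0)=1$, and $(\xi,\eta)\mapsto\psi(\arccos\langle\xi,\eta\rangle)$ is positive definite on the unit sphere $\mathbb S^d\subset\mathbb R^{d+1}$. Let $C_n^\lambda$ be the Gegenbauer polynomials, $(1+r^2-2r\cos\theta)^{-\lambda}=\sum_{n\ge0}r^nC_n^\lambda(\cos\theta)$, and $(x)_m:=x(x+1)\cdots(x+m-1)$, $(x)_0:=1$. Let $$b_{n,d}:=\frac{(n+\lambda)\Gamma(\lambda)}{\Gamma(\lambda+\frac12)\Gamma(\frac12)}\int_0^\pi C_n^\lambda(\cos\theta)\,\psi(\theta)(\sin\theta)^{2\lambda}\,d\theta\qquad(n\ge0)$$ be the $d$-Schoenberg coefficients of $\psi$, and let $$b_{0,1}:=\frac1\pi\int_0^\pi\psi(\theta)\,d\theta,\qquad b_{n,1}:=\frac2\pi\int_0^\pi\psi(\theta)\cos(n\theta)\,d\theta\quad(n\ge1)$$ be its $1$-Schoenberg coefficients; put $b_{0,1}^*:=2b_{0,1}$ and $b_{n,1}^*:=b_{n,1}$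 for $n\ge1$. (a) If $(b_n)_{n\ge0}$ is a sequence of non-negative numbers with $\sum_n b_n=1$ and $\psi(\theta)=\sum_{n=0}^\infty b_n\,C_n^\lambda(\cos\theta)/C_n^\lambda(1)$ for all $\theta\in[0,\pi]$, then $b_n=b_{n,d}$ for every $n$. (b) For every $n\ge0$ the series below converges absolutely and $$b_{n,d}=\frac{\sqrt\pi\,\Gamma(n+2\lambda)}{2^{2\lambda}\,\Gamma(\lambda+\frac12)\,\Gamma(n+\lambda)}\left[b_{n,1}^*-\lambda\sum_{\mu=1}^\infty\frac{(1-\lambda)_{\mu-1}(n+1)_{\mu-1}(n+2\mu)}{\mu!\,(n+\lambda+1)_\mu}\,b_{n+2\mu,1}\right].$$ (c) If $d$ is odd, the coefficient of $b_{n+2\mu,1}$ vanishes for all $\mu>\lambda$, so that the formula in (b) is a finite sum over $1\le\mu\le\lambda$ and involves only $b_{n,1}^*,b_{n+2,1},\dots,b_{n+2\lambda,1}$. -/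

import Mathlib

open Real Set Filter Topology

/-- The Gegenbauer (ultraspherical) polynomials `C_n^lam`, as real functions, by their three-term
recurrence `m C_m = 2 (m + lam - 1) x C_{m-1} - (m + 2 lam - 2) C_{m-2}`.  That these are the
coefficients of the generating function `(1 + r ^ 2 - 2 r x) ^ (-lam)` is proved in
`gegenbauer_eq_taylorCoeff` below. -/
noncomputable def gegenbauer (lam : ℝ) : ℕ → ℝ → ℝ
  | 0, _ => 1
  | 1, x => 2 * lam * x
  | n + 2, x => (2 * ((n : ℝ) + 1 + lam) * x * gegenbauer lam (n + 1) x
      - ((n : ℝ) + 2 * lam) * gegenbauer lam n x) / ((n : ℝ) + 2)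

theorem gegenbauer_generating_ode (lam x : ℝ) (n : ℕ) :
    ∀ r ∈ {r : ℝ | 0 < 1 + r ^ 2 - 2 * r * x},
      (1 + r ^ 2 - 2 * r * x)
          * iteratedDeriv (n + 2) (fun s : ℝ => (1 + s ^ 2 - 2 * s * x) ^ (-lam)) r
        = 2 * ((n : ℝ) + 1 + lam) * (x - r)
            * iteratedDeriv (n + 1) (fun s : ℝ => (1 + s ^ 2 - 2 * s * x) ^ (-lam)) r
          - ((n : ℝ) + 1) * ((n : ℝ) + 2 * lam)
            * iteratedDeriv n (fun s : ℝ => (1 + s ^ 2 - 2 * s * x) ^ (-lam)) r := by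
  set f : ℝ → ℝ := fun s => (1 + s ^ 2 - 2 * s * x) ^ (-lam) with hf
  set U : Set ℝ := {r : ℝ | 0 < 1 + r ^ 2 - 2 * r * x} with hU
  have hUo : IsOpen U := isOpen_lt continuous_const (by fun_prop)
  have hg : ∀ r, HasDerivAt (fun s : ℝ => 1 + s ^ 2 - 2 * s * x) (2 * (r - x)) r := by
    intro r
    have h1 : HasDerivAt (fun s : ℝ => s) 1 r := hasDerivAt_id r
    have := ((h1.pow 2).const_add 1).sub ((h1.const_mul 2).mul_const x)
    exact this.congr_deriv (by push_cast; ring)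
  have hsm : ∀ r ∈ U, ∀ k : ℕ, HasDerivAt (iteratedDeriv k f) (iteratedDeriv (k + 1) f r) r := by
    intro r hr k
    have hc : ContDiffOn ℝ (↑(k + 1 : ℕ)) f U := by
      apply ContDiffOn.rpow_const_of_ne
      · fun_prop
      · exact fun s hs => ne_of_gt hs
    have hd : DifferentiableAt ℝ (iteratedDeriv k f) r := by
      have h1 := (hc.differentiableOn_iteratedDerivWithin (m := k)
        (by exact_mod_cast Nat.lt_succ_self k) hUo.uniqueDiffOn).congr
        (fun s hs => (iteratedDerivWithin_of_isOpen hUo hs).symm)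
      exact h1.differentiableAt (hUo.mem_nhds hr)
    rw [iteratedDeriv_succ]
    exact hd.hasDerivAt
  have base : ∀ r ∈ U, (1 + r ^ 2 - 2 * r * x) * iteratedDeriv 1 f r
      = 2 * lam * (x - r) * iteratedDeriv 0 f r := by
    intro r hr
    have h := (hg r).rpow_const (p := -lam) (Or.inl (ne_of_gt hr))
    have hp : (1 + r ^ 2 - 2 * r * x) * (1 + r ^ 2 - 2 * r * x) ^ (-lam - 1) = f r := by
      have h0 : (1 + r ^ 2 - 2 * r * x) ≠ 0 := ne_of_gt hr
      rw [Real.rpow_sub_one h0, mul_div_cancel₀ _ h0]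
    rw [iteratedDeriv_one, iteratedDeriv_zero, h.deriv, ← hp]
    ring
  have key : ∀ (F G : ℝ → ℝ) (a b r : ℝ), r ∈ U → (∀ s ∈ U, F s = G s) →
      HasDerivAt F a r → HasDerivAt G b r → a = b := by
    intro F G a b r hr hFG hF hG
    have he : F =ᶠ[𝓝 r] G := Filter.eventually_of_mem (hUo.mem_nhds hr) hFG
    exact hF.unique (hG.congr_of_eventuallyEq he)
  have hx : ∀ r : ℝ, HasDerivAt (fun s : ℝ => x - s) (-1) r := fun r => (hasDerivAt_id r).const_sub x
  induction n with
  | zero =>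
    intro r hr
    have h := key _ _ _ _ r hr base ((hg r).mul (hsm r hr 1))
      (((hx r).const_mul (2 * lam)).mul (hsm r hr 0))
    simp only [Nat.cast_zero, zero_add] at h ⊢
    linear_combination h
  | succ n ih =>
    intro r hr
    have h := key _ _ _ _ r hr ih ((hg r).mul (hsm r hr (n + 2)))
      ((((hx r).const_mul (2 * ((n : ℝ) + 1 + lam))).mul (hsm r hr (n + 1))).sub
        ((hsm r hr n).const_mul (((n : ℝ) + 1) * ((n : ℝ) + 2 * lam))))
    push_cast
    linear_combination h

/-- `C_n^lam (x)` is the coefficient of `r ^ n` in the expansion of `(1 + r ^ 2 - 2 r x) ^ (-lam)`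
at `r = 0`. -/
theorem gegenbauer_eq_taylorCoeff (lam x : ℝ) (n : ℕ) :
    gegenbauer lam n x
      = iteratedDeriv n (fun r : ℝ => (1 + r ^ 2 - 2 * r * x) ^ (-lam)) 0 / (n.factorial : ℝ) := by
  induction n using Nat.twoStepInduction with
  | zero => simp [gegenbauer]
  | one =>
    have h1 : HasDerivAt (fun s : ℝ => s) 1 (0 : ℝ) := hasDerivAt_id 0
    have hg := ((h1.pow 2).const_add 1).sub ((h1.const_mul 2).mul_const x)
    have h := (hg.rpow_const (p := -lam) (Or.inl (by simp)))
    have h2 : deriv (fun r : ℝ => (1 + r ^ 2 - 2 * r * x) ^ (-lam)) 0 = 2 * lam * x := by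
      refine h.deriv.trans ?_
      simp; ring
    rw [iteratedDeriv_one, h2]
    simp [gegenbauer]
  | more n ih0 ih1 =>
    have h := gegenbauer_generating_ode lam x n 0 (by simp)
    have hn : (n.factorial : ℝ) ≠ 0 := by positivity
    rw [gegenbauer, ih0, ih1]
    generalize iteratedDeriv (n + 2) (fun r : ℝ => (1 + r ^ 2 - 2 * r * x) ^ (-lam)) 0 = A at *
    generalize iteratedDeriv (n + 1) (fun r : ℝ => (1 + r ^ 2 - 2 * r * x) ^ (-lam)) 0 = B at *
    generalize iteratedDeriv n (fun r : ℝ => (1 + r ^ 2 - 2 * r * x) ^ (-lam)) 0 = D at *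
    simp only [Nat.factorial_succ]
    push_cast
    field_simp
    linear_combination (-((n : ℝ) + 2)) * h

/-- `lam = (d - 1) / 2`. -/
noncomputable def lamOf (d : ℕ) : ℝ := ((d : ℝ) - 1) / 2

/-- The rising factorial `(x)_m = x (x + 1) ⋯ (x + m - 1)`. -/
noncomputable def rising (x : ℝ) (m : ℕ) : ℝ := (ascPochhammer ℝ m).eval x

/-- The unit sphere `𝕊^d` in `ℝ^(d+1)`. -/
abbrev UnitSphere (d : ℕ) : Type := Metric.sphere (0 : EuclideanSpace ℝ (Fin (d + 1))) 1

/-- The great circle distance on `𝕊^d`. -/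
noncomputable def geodesicDist {d : ℕ} (ξ η : UnitSphere d) : ℝ :=
  Real.arccos (inner ℝ (ξ : EuclideanSpace ℝ (Fin (d + 1))) (η : EuclideanSpace ℝ (Fin (d + 1))))

/-- Positive definiteness of a real function on `𝕊^d × 𝕊^d`. -/
def IsPosDefKernel {d : ℕ} (C : UnitSphere d → UnitSphere d → ℝ) : Prop :=
  ∀ (m : ℕ) (α : Fin m → ℝ) (x : Fin m → UnitSphere d),
    0 ≤ ∑ i, ∑ j, α i * α j * C (x i) (x j)

/-- The class `Ψ_d`.  Only the values of `ψ` on `[0, π]` matter. -/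
def PsiClass (d : ℕ) : Set (ℝ → ℝ) :=
  {ψ | ContinuousOn ψ (Icc 0 π) ∧ ψ 0 = 1 ∧
    IsPosDefKernel (fun ξ η : UnitSphere d => ψ (geodesicDist ξ η))}

/-- For `d > 1`: `b` is a probability mass system on `ℕ` with
`ψ θ = ∑ b_n C_n^lam (cos θ) / C_n^lam (1)` on `[0, π]`. -/
def IsSchoenbergSeq (d : ℕ) (ψ : ℝ → ℝ) (b : ℕ → ℝ) : Prop :=
  (∀ n, 0 ≤ b n) ∧ HasSum b 1 ∧
    ∀ θ ∈ Icc (0 : ℝ) π,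
      HasSum (fun n => b n * (gegenbauer (lamOf d) n (Real.cos θ) / gegenbauer (lamOf d) n 1)) (ψ θ)

/-- The `d`-Schoenberg coefficient `b_{n,d}` of `ψ`, for `d > 1`, in integral form.  Here
`d - 1 = 2 lam` is the exponent of the sine. -/
noncomputable def schoenbergCoeff (d : ℕ) (ψ : ℝ → ℝ) (n : ℕ) : ℝ :=
  ((n : ℝ) + lamOf d) * Real.Gamma (lamOf d)
      / (Real.Gamma (lamOf d + 1 / 2) * Real.Gamma (1 / 2))
    * ∫ θ in (0 : ℝ)..π, gegenbauer (lamOf d) n (Real.cos θ) * ψ θ * Real.sin θ ^ (d - 1)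

/-- The `1`-Schoenberg coefficient `b_{n,1}` of `ψ`: the Fourier cosine coefficient. -/
noncomputable def circleCoeff (ψ : ℝ → ℝ) (n : ℕ) : ℝ :=
  if n = 0 then 1 / π * ∫ θ in (0 : ℝ)..π, ψ θ
  else 2 / π * ∫ θ in (0 : ℝ)..π, ψ θ * Real.cos (n * θ)

/-- `b_{n,1}^*`, equal to `b_{n,1}` for `n ≥ 1` and to `2 b_{0,1}` for `n = 0`. -/
noncomputable def circleCoeffStar (ψ : ℝ → ℝ) (n : ℕ) : ℝ :=
  if n = 0 then 2 * circleCoeff ψ 0 else circleCoeff ψ n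

/-- The factor in front of the bracket,
`√π Γ(n + 2 lam) / (2 ^ (2 lam) Γ(lam + 1/2) Γ(n + lam))`. -/
noncomputable def leadFactor (lam : ℝ) (n : ℕ) : ℝ :=
  √π * Real.Gamma (n + 2 * lam)
    / ((2 : ℝ) ^ (2 * lam) * Real.Gamma (lam + 1 / 2) * Real.Gamma (n + lam))

/-- The coefficient of `b_{n+2μ,1}` in the series, for `μ ≥ 1` (never used at `μ = 0`). -/
noncomputable def seriesCoeff (lam : ℝ) (n μ : ℕ) : ℝ :=
  rising (1 - lam) (μ - 1) * rising ((n : ℝ) + 1) (μ - 1) * ((n : ℝ) + 2 * μ)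
    / ((μ.factorial : ℝ) * rising ((n : ℝ) + lam + 1) μ)

/-! Write `k = d - 1 = 2λ`. The coefficient `b_{n,d}` pairs `ψ` with the fixed continuous function
`C_n^λ(cos θ) sin^k θ`, whereas `b_{m,1}` pairs `ψ` with `cos mθ`. So (b) amounts to the cosine
expansion of `C_n^λ(cos θ) sin^k θ`, integrated term by term against `ψ`. The expansion is explicit.
Integration by parts gives a two-step recurrence for the cosine moments of `sin^k`, and the
three-term recurrence of `C_n^λ` carries their closed form to all `n` (`gegenbauerMoment_eq`). The
moment at frequency `m` vanishes if `m - n` is odd or `|m| < n`, which leaves `m = ±(n + 2μ)` with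
`μ ≥ 0`: the term `μ = 0` is the leading one and the terms `μ ≥ 1` form the series. The moments are
absolutely summable because the recurrence telescopes, so the cosine series converges pointwise and
dominated convergence applies. For (a), `C_m^λ(cos θ)` is a combination of `cos jθ` with `|j| ≤ m`
(`gegenbauer_cos`), so the same vanishing moments give orthogonality; integrating the expansion of
`ψ` against `C_n^λ(cos θ) sin^k θ` isolates `b_n`. For (c), `(1-λ)_{μ-1}` contains the factor zero
once `μ` exceeds the integer `λ`. -/

/-! ### Rising factorials; continuity of Gegenbauer polynomials and their value at 1. -/

theorem rising_zero (x : ℝ) : rising x 0 = 1 := by simp [rising]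

theorem rising_succ (x : ℝ) (m : ℕ) : rising x (m + 1) = rising x m * (x + m) := by
  simp [rising, ascPochhammer_succ_eval]

theorem rising_succ_left (x : ℝ) (m : ℕ) : rising x (m + 1) = x * rising (x + 1) m := by
  simp [rising, ascPochhammer_succ_left, Polynomial.eval_comp]

theorem rising_pos {x : ℝ} (hx : 0 < x) (m : ℕ) : 0 < rising x m :=
  ascPochhammer_pos m x hx

theorem continuous_gegenbauer (lam : ℝ) (n : ℕ) : Continuous (gegenbauer lam n) := by
  induction n using Nat.twoStepInduction with
  | zero =>
    exact (continuous_const : Continuous fun _ : ℝ => (1 : ℝ)).congr fun x => by simp [gegenbauer]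
  | one =>
    exact (continuous_const.mul continuous_id : Continuous fun x : ℝ => 2 * lam * x).congr
      fun x => by simp [gegenbauer]
  | more n ih0 ih1 =>
    refine Continuous.congr (f := fun x => (2 * ((n : ℝ) + 1 + lam) * x * gegenbauer lam (n + 1) x
      - ((n : ℝ) + 2 * lam) * gegenbauer lam n x) / ((n : ℝ) + 2)) (by fun_prop) fun x => ?_
    rw [gegenbauer]

theorem gegenbauer_apply_one (lam : ℝ) (n : ℕ) :
    gegenbauer lam n 1 = rising (2 * lam) n / n.factorial := by
  induction n using Nat.twoStepInduction with
  | zero => simp [gegenbauer, rising_zero]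
  | one => simp [gegenbauer, rising_succ, rising_zero]
  | more n ih0 ih1 =>
    have hn : (n.factorial : ℝ) ≠ 0 := by positivity
    rw [gegenbauer, ih0, ih1]
    simp only [Nat.factorial_succ, rising_succ]
    push_cast
    field_simp
    ring

theorem gegenbauer_one_pos {lam : ℝ} (hlam : 0 < lam) (n : ℕ) : 0 < gegenbauer lam n 1 := by
  rw [gegenbauer_apply_one]
  exact div_pos (rising_pos (by positivity) n) (by positivity)

/-! ### `C_n^λ(cos θ)` as a cosine polynomial. -/

/-- The Taylor coefficients of `(1 - r) ^ (-lam)`. -/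
noncomputable def binomCoeff (lam : ℝ) (j : ℕ) : ℝ := rising lam j / j.factorial

theorem binomCoeff_zero (lam : ℝ) : binomCoeff lam 0 = 1 := by simp [binomCoeff, rising_zero]

theorem binomCoeff_succ (lam : ℝ) (j : ℕ) :
    ((j : ℝ) + 1) * binomCoeff lam (j + 1) = (lam + j) * binomCoeff lam j := by
  have hj : (j.factorial : ℝ) ≠ 0 := by positivity
  simp only [binomCoeff, rising_succ, Nat.factorial_succ]
  push_cast
  field_simp

theorem binomCoeff_pos {lam : ℝ} (hlam : 0 < lam) (j : ℕ) : 0 < binomCoeff lam j :=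
  div_pos (rising_pos hlam j) (by positivity)

/-- The formal power series `(1 - z X) ^ (-lam)`. -/
noncomputable def binomSeries (lam : ℝ) (z : ℂ) : PowerSeries ℂ :=
  PowerSeries.mk fun j => (binomCoeff lam j : ℂ) * z ^ j

theorem derivative_binomSeries (lam : ℝ) (z : ℂ) :
    (1 - PowerSeries.C z * PowerSeries.X)
        * PowerSeries.derivative ℂ (binomSeries lam z)
      = PowerSeries.C (lam * z) * binomSeries lam z := by
  have hc : ∀ j : ℕ, ((j : ℂ) + 1) * (binomCoeff lam (j + 1) : ℂ)
      = (lam + j) * (binomCoeff lam j : ℂ) := fun j => by exact_mod_cast binomCoeff_succ lam j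
  ext j
  rw [sub_mul, one_mul, mul_assoc, map_sub, PowerSeries.coeff_C_mul, PowerSeries.coeff_C_mul]
  cases j with
  | zero =>
    have := hc 0
    simp only [PowerSeries.coeff_zero_X_mul, PowerSeries.coeff_derivative, binomSeries,
      PowerSeries.coeff_mk]
    push_cast at this ⊢
    linear_combination z * this
  | succ j =>
    have := hc (j + 1)
    simp only [PowerSeries.coeff_succ_X_mul, PowerSeries.coeff_derivative, binomSeries,
      PowerSeries.coeff_mk]
    push_cast at this ⊢
    linear_combination z ^ (j + 2) * this

/-- Since `(1 - zX)(1 - wX) = 1 - 2xX + X²`, the product is formally the generating function. It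
satisfies the corresponding first-order differential equation, whose coefficients obey the
Gegenbauer recurrence. -/
theorem gegenbauer_eq_coeff_binomSeries_mul (lam x : ℝ) (z w : ℂ) (hzw : z * w = 1)
    (hx : z + w = 2 * x) (n : ℕ) :
    (gegenbauer lam n x : ℂ)
      = PowerSeries.coeff n (binomSeries lam z * binomSeries lam w) := by
  set F := binomSeries lam z * binomSeries lam w with hF
  have ode : (1 - PowerSeries.C (2 * x : ℂ) * PowerSeries.X + PowerSeries.X * PowerSeries.X)
        * PowerSeries.derivative ℂ F
      = PowerSeries.C (2 * lam * x : ℂ) * F - PowerSeries.C (2 * lam : ℂ) * (PowerSeries.X * F) := by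
    have h1 := derivative_binomSeries lam z
    have h2 := derivative_binomSeries lam w
    have hd : PowerSeries.derivative ℂ F
        = PowerSeries.derivative ℂ (binomSeries lam z) * binomSeries lam w
          + binomSeries lam z * PowerSeries.derivative ℂ (binomSeries lam w) := by
      rw [hF, Derivation.leibniz]
      simp only [smul_eq_mul]
      ring
    have e1 : (PowerSeries.C z : PowerSeries ℂ) * PowerSeries.C w = 1 := by
      rw [← map_mul, hzw, map_one]
    have e2 : (PowerSeries.C (2 * x : ℂ) : PowerSeries ℂ) = PowerSeries.C z + PowerSeries.C w := by
      rw [← map_add, hx]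
    have e3 : (PowerSeries.C (2 * lam * x : ℂ) : PowerSeries ℂ)
        = PowerSeries.C (lam : ℂ) * (PowerSeries.C z + PowerSeries.C w) := by
      rw [← map_add, ← map_mul, hx]; congr 1; ring
    have e4 : (PowerSeries.C (2 * lam : ℂ) : PowerSeries ℂ) = 2 * PowerSeries.C (lam : ℂ) := by
      rw [map_mul, map_ofNat]
    rw [map_mul] at h1 h2
    rw [hd, e2, e3, e4, hF]
    set Z : PowerSeries ℂ := PowerSeries.C z
    set W : PowerSeries ℂ := PowerSeries.C w
    linear_combination (1 - W * PowerSeries.X) * binomSeries lam w * h1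
      + (1 - Z * PowerSeries.X) * binomSeries lam z * h2
      - (PowerSeries.X ^ 2 * (PowerSeries.derivative ℂ (binomSeries lam z) * binomSeries lam w
          + binomSeries lam z * PowerSeries.derivative ℂ (binomSeries lam w))
        + 2 * PowerSeries.C (lam : ℂ) * PowerSeries.X * binomSeries lam z * binomSeries lam w) * e1
  have coeffs : ∀ m, PowerSeries.coeff m ((1 - PowerSeries.C (2 * x : ℂ) * PowerSeries.X
        + PowerSeries.X * PowerSeries.X) * PowerSeries.derivative ℂ F)
      = PowerSeries.coeff m (PowerSeries.C (2 * lam * x : ℂ) * F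
        - PowerSeries.C (2 * lam : ℂ) * (PowerSeries.X * F)) := fun m => by rw [ode]
  simp only [add_mul, sub_mul, one_mul, mul_assoc, map_add, map_sub, PowerSeries.coeff_C_mul]
    at coeffs
  have hF0 : PowerSeries.coeff 0 F = 1 := by
    simp [hF, binomSeries, binomCoeff_zero, PowerSeries.coeff_mul]
  induction n using Nat.twoStepInduction with
  | zero => simp [gegenbauer, hF0]
  | one =>
    have h := coeffs 0
    simp only [PowerSeries.coeff_zero_X_mul, PowerSeries.coeff_derivative, hF0] at h
    push_cast at h
    simp only [gegenbauer]
    push_cast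
    linear_combination -h
  | more n ih0 ih1 =>
    have h := coeffs (n + 1)
    have hn : ((n : ℂ) + 2) ≠ 0 := by exact_mod_cast (by omega : n + 2 ≠ 0)
    rw [gegenbauer]
    push_cast
    rw [ih0, ih1, div_eq_iff hn]
    cases n with
    | zero =>
      simp only [PowerSeries.coeff_succ_X_mul, PowerSeries.coeff_zero_X_mul,
        PowerSeries.coeff_derivative] at h
      push_cast at h ⊢
      linear_combination -h
    | succ n =>
      simp only [PowerSeries.coeff_succ_X_mul, PowerSeries.coeff_derivative] at h
      push_cast at h ⊢
      linear_combination -h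

/-- The factorisation is applied with `z = e^{iθ}`, `w = e^{-iθ}`, and real parts are taken. -/
theorem gegenbauer_cos (lam : ℝ) (n : ℕ) (θ : ℝ) :
    gegenbauer lam n (Real.cos θ) = ∑ p ∈ Finset.HasAntidiagonal.antidiagonal n,
      binomCoeff lam p.1 * binomCoeff lam p.2 * Real.cos (((p.1 : ℤ) - (p.2 : ℤ) : ℤ) * θ) := by
  have h := gegenbauer_eq_coeff_binomSeries_mul lam (Real.cos θ) (Complex.exp (θ * Complex.I))
    (Complex.exp (-(θ * Complex.I))) (by rw [← Complex.exp_add]; simp)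
    (by rw [Complex.ofReal_cos, Complex.cos]; ring_nf) n
  have h' := congrArg Complex.re h
  rw [Complex.ofReal_re, PowerSeries.coeff_mul, Complex.re_sum] at h'
  rw [h']
  refine Finset.sum_congr rfl fun p _ => ?_
  simp only [binomSeries, PowerSeries.coeff_mk]
  have e : (binomCoeff lam p.1 : ℂ) * Complex.exp (θ * Complex.I) ^ p.1
      * ((binomCoeff lam p.2 : ℂ) * Complex.exp (-(θ * Complex.I)) ^ p.2)
      = ((binomCoeff lam p.1 * binomCoeff lam p.2 : ℝ) : ℂ)
        * Complex.exp (((((p.1 : ℤ) - (p.2 : ℤ) : ℤ) * θ : ℝ) : ℂ) * Complex.I) := by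
    rw [← Complex.exp_nat_mul, ← Complex.exp_nat_mul]
    push_cast
    rw [show ((p.1 : ℂ) - p.2) * θ * Complex.I
      = p.1 * (θ * Complex.I) + p.2 * (-(θ * Complex.I)) by ring, Complex.exp_add]
    ring
  rw [e, Complex.re_ofReal_mul, Complex.exp_ofReal_mul_I_re]

/-- For `λ > 0` all coefficients of the cosine polynomial are positive, so its modulus is largest at
`θ = 0`. -/
theorem abs_gegenbauer_cos_le {lam : ℝ} (hlam : 0 < lam) (n : ℕ) (θ : ℝ) :
    |gegenbauer lam n (Real.cos θ)| ≤ gegenbauer lam n 1 := by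
  have h1 := gegenbauer_cos lam n 0
  simp only [Real.cos_zero, mul_zero, mul_one] at h1
  rw [gegenbauer_cos, h1]
  refine (Finset.abs_sum_le_sum_abs _ _).trans (Finset.sum_le_sum fun p _ => ?_)
  have hp := mul_pos (binomCoeff_pos hlam p.1) (binomCoeff_pos hlam p.2)
  rw [abs_mul, abs_of_pos hp]
  exact mul_le_of_le_one_right hp.le (Real.abs_cos_le_one _)

/-! ### Cosine moments of `sin^k`. -/

/-- The cosine moments of the weight `sin ^ k` on `[0, π]`. -/
noncomputable def sinMoment (k : ℕ) (m : ℤ) : ℝ :=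
  ∫ θ in (0 : ℝ)..π, Real.cos (m * θ) * Real.sin θ ^ k

theorem sinMoment_neg (k : ℕ) (m : ℤ) : sinMoment k (-m) = sinMoment k m := by
  simp [sinMoment]

/-- The integral of the derivative of `2 sin^(k+1) θ cos((m+1)θ)` is zero, as this function vanishes
at both ends. -/
theorem sinMoment_add_two (k : ℕ) (m : ℤ) :
    ((k : ℝ) + m + 2) * sinMoment k (m + 2) = (m - k) * sinMoment k m := by
  have hd : ∀ θ ∈ uIcc (0 : ℝ) π, HasDerivAt
      (fun θ => 2 * (Real.sin θ ^ (k + 1) * Real.cos (((m : ℝ) + 1) * θ)))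
      (((k : ℝ) + m + 2) * (Real.cos ((m + 2 : ℤ) * θ) * Real.sin θ ^ k)
        - (m - k) * (Real.cos (m * θ) * Real.sin θ ^ k)) θ := by
    intro θ _
    have h1 := (Real.hasDerivAt_sin θ).pow (k + 1)
    have h2 := (Real.hasDerivAt_cos (((m : ℝ) + 1) * θ)).comp θ
      ((hasDerivAt_id θ).const_mul ((m : ℝ) + 1))
    refine ((h1.mul h2).const_mul 2).congr_deriv ?_
    have e1 : Real.cos ((m + 2 : ℤ) * θ)
        = Real.cos ((m + 1) * θ) * Real.cos θ - Real.sin ((m + 1) * θ) * Real.sin θ := by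
      rw [← Real.cos_add]; push_cast; ring_nf
    have e2 : Real.cos (m * θ)
        = Real.cos ((m + 1) * θ) * Real.cos θ + Real.sin ((m + 1) * θ) * Real.sin θ := by
      rw [← Real.cos_sub]; ring_nf
    rw [e1, e2]
    simp only [Function.comp_apply, Pi.pow_apply, Nat.add_sub_cancel]
    push_cast
    ring
  have h := intervalIntegral.integral_eq_sub_of_hasDerivAt hd
    (Continuous.intervalIntegrable (by fun_prop) _ _)
  rw [intervalIntegral.integral_sub (Continuous.intervalIntegrable (by fun_prop) _ _)
    (Continuous.intervalIntegrable (by fun_prop) _ _), intervalIntegral.integral_const_mul,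
    intervalIntegral.integral_const_mul] at h
  simp only [Real.sin_pi, Real.sin_zero, zero_pow (Nat.succ_ne_zero k), zero_mul, mul_zero,
    sub_zero] at h
  simp only [sinMoment]
  linarith

theorem sinMoment_odd (k : ℕ) (s : ℤ) : sinMoment k (2 * s + 1) = 0 := by
  have hnat : ∀ s : ℕ, sinMoment k (2 * s + 1) = 0 := by
    intro s
    induction s with
    | zero =>
      -- At `m = -1` the recurrence links the moments at `1` and `-1` with opposite signs, while
      -- evenness makes them equal.
      have h := sinMoment_add_two k (-1)
      rw [sinMoment_neg] at h
      rw [show (-1 : ℤ) + 2 = 1 by norm_num] at h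
      push_cast at h
      have h0 : (2 * ((k : ℝ) + 1)) * sinMoment k 1 = 0 := by linear_combination h
      simpa using (mul_eq_zero.mp h0).resolve_left (by positivity)
    | succ s ih =>
      have h := sinMoment_add_two k (2 * s + 1)
      rw [ih, mul_zero] at h
      rw [show (2 * ((s + 1 : ℕ) : ℤ) + 1) = 2 * s + 1 + 2 by push_cast; ring]
      exact (mul_eq_zero.mp h).resolve_left (by positivity)
  obtain ⟨t, rfl | rfl⟩ := s.eq_nat_or_neg
  · exact hnat t
  · cases t with
    | zero => simpa using hnat 0
    | succ t =>
      rw [← sinMoment_neg, ← hnat t]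
      exact congrArg _ (by push_cast; ring)

theorem sinMoment_zero (k : ℕ) :
    sinMoment k 0 = √π * Real.Gamma ((k : ℝ) / 2 + 1 / 2) / Real.Gamma ((k : ℝ) / 2 + 1) := by
  have e : ∀ k, sinMoment k 0 = ∫ θ in (0 : ℝ)..π, Real.sin θ ^ k := fun k => by simp [sinMoment]
  induction k using Nat.twoStepInduction with
  | zero =>
    rw [e]
    norm_num [Real.Gamma_one_half_eq, Real.mul_self_sqrt Real.pi_pos.le]
  | one =>
    rw [e]
    have h := Real.Gamma_add_one (s := 1 / 2) (by norm_num)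
    have h2 : √π ≠ 0 := by positivity
    norm_num [Real.Gamma_one_half_eq] at h ⊢
    rw [show (3 / 2 : ℝ) = 1 / 2 + 1 by norm_num, Real.Gamma_add_one (by norm_num),
      Real.Gamma_one_half_eq]
    field_simp
  | more k ih0 _ =>
    rw [e, integral_sin_pow, ← e, ih0]
    have h1 := Real.Gamma_add_one (s := (k : ℝ) / 2 + 1 / 2) (by positivity)
    have h2 := Real.Gamma_add_one (s := (k : ℝ) / 2 + 1) (by positivity)
    have hG : Real.Gamma ((k : ℝ) / 2 + 1) ≠ 0 := (Real.Gamma_pos_of_pos (by positivity)).ne'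
    rw [show (((k + 2 : ℕ) : ℝ) / 2 + 1 / 2) = (k : ℝ) / 2 + 1 / 2 + 1 by push_cast; ring,
      show (((k + 2 : ℕ) : ℝ) / 2 + 1) = (k : ℝ) / 2 + 1 + 1 by push_cast; ring, h1, h2]
    simp only [Real.sin_pi, Real.sin_zero, zero_pow (Nat.succ_ne_zero k), zero_mul, sub_zero,
      zero_div, zero_add]
    field_simp

/-- No pole is excluded, since `Real.Gamma` takes the value `0` there and `0⁻¹ = 0`. This matters
for even `k`, where `1 + λ - μ` reaches the poles. -/
theorem inv_Gamma_eq (s : ℝ) : (Real.Gamma s)⁻¹ = s * (Real.Gamma (s + 1))⁻¹ := by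
  rcases eq_or_ne s 0 with rfl | hs
  · simp
  · rw [Real.Gamma_add_one hs, mul_inv, ← mul_assoc, mul_inv_cancel₀ hs, one_mul]

/-- The non-polynomial factor of the Fourier coefficients of `sin ^ (2 lam) * C_n ^ lam (cos ·)`. -/
noncomputable def gammaKernel (lam : ℝ) (n : ℕ) (μ : ℤ) : ℝ :=
  (-1) ^ μ * (Real.Gamma (1 + lam - μ))⁻¹ * (Real.Gamma (n + lam + 1 + μ))⁻¹

/-- Together with `gammaKernel_eq_mul`, this puts the kernel at `μ + 1` and at `μ` over one common
Gamma product, which turns recurrences into polynomial identities. -/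
theorem gammaKernel_succ_right (lam : ℝ) (n : ℕ) (μ : ℤ) :
    gammaKernel lam n (μ + 1) = -(lam - μ) * ((-1) ^ μ * (Real.Gamma (1 + lam - μ))⁻¹
      * (Real.Gamma (n + lam + 2 + μ))⁻¹) := by
  have h := inv_Gamma_eq (lam - μ)
  rw [gammaKernel, zpow_add_one₀ (by norm_num)]
  push_cast
  rw [show 1 + lam - ((μ : ℝ) + 1) = lam - μ by ring, h,
    show lam - (μ : ℝ) + 1 = 1 + lam - μ by ring,
    show (n : ℝ) + lam + 1 + (μ + 1) = n + lam + 2 + μ by ring]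
  ring

theorem gammaKernel_eq_mul (lam : ℝ) (n : ℕ) (μ : ℤ) :
    gammaKernel lam n μ = (n + lam + 1 + μ) * ((-1) ^ μ * (Real.Gamma (1 + lam - μ))⁻¹
      * (Real.Gamma (n + lam + 2 + μ))⁻¹) := by
  rw [gammaKernel, inv_Gamma_eq (n + lam + 1 + μ),
    show (n : ℝ) + lam + 1 + μ + 1 = n + lam + 2 + μ by ring]
  ring

theorem gammaKernel_zero_neg (lam : ℝ) (μ : ℤ) :
    gammaKernel lam 0 (-μ) = gammaKernel lam 0 μ := by
  simp only [gammaKernel, zpow_neg, Nat.cast_zero, Int.cast_neg, sub_neg_eq_add, zero_add]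
  rw [← inv_zpow, show ((-1 : ℝ))⁻¹ = -1 by norm_num,
    show 1 + lam + (μ : ℝ) = lam + 1 + μ by ring, show lam + 1 + -(μ : ℝ) = 1 + lam - μ by ring]
  ring

/-- The constant in front of the Fourier coefficients of `sin ^ k * C_n ^ (k / 2) (cos ·)`. -/
noncomputable def momentConst (k : ℕ) : ℝ :=
  √π * Real.Gamma ((k : ℝ) / 2 + 1 / 2) * Real.Gamma ((k : ℝ) / 2 + 1) / 2

theorem sinMoment_even (k : ℕ) (s : ℤ) :
    sinMoment k (2 * s) = momentConst k * 2 * gammaKernel ((k : ℝ) / 2) 0 s := by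
  have hnat : ∀ s : ℕ, sinMoment k (2 * s)
      = momentConst k * 2 * gammaKernel ((k : ℝ) / 2) 0 s := by
    intro s
    induction s with
    | zero =>
      have hG : Real.Gamma ((k : ℝ) / 2 + 1) ≠ 0 := (Real.Gamma_pos_of_pos (by positivity)).ne'
      simp only [Nat.cast_zero, mul_zero, sinMoment_zero, gammaKernel, momentConst, zpow_zero,
        Int.cast_zero, add_zero, sub_zero, zero_add, add_comm (1 : ℝ)]
      field_simp
    | succ s ih =>
      have h := sinMoment_add_two k (2 * s)
      have hpos : (k : ℝ) + (2 * s : ℤ) + 2 ≠ 0 := by push_cast; positivity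
      rw [show (2 * ((s + 1 : ℕ) : ℤ)) = 2 * s + 2 by push_cast; ring, Nat.cast_succ,
        gammaKernel_succ_right]
      rw [ih, gammaKernel_eq_mul] at h
      apply mul_left_cancel₀ hpos
      rw [h]
      push_cast
      ring
  obtain ⟨t, rfl | rfl⟩ := s.eq_nat_or_neg
  · exact hnat t
  · rw [mul_neg, sinMoment_neg, gammaKernel_zero_neg, hnat]

/-! ### Closed form of the cosine moments of `C_n^λ(cos θ) sin^k θ`. -/

/-- The cosine moments of `C_n ^ (k / 2) (cos ·)` against the weight `sin ^ k`. -/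
noncomputable def gegenbauerMoment (k n : ℕ) (m : ℤ) : ℝ :=
  ∫ θ in (0 : ℝ)..π,
    Real.cos (m * θ) * (gegenbauer ((k : ℝ) / 2) n (Real.cos θ) * Real.sin θ ^ k)

theorem continuous_gegenbauer_cos (lam : ℝ) (n : ℕ) :
    Continuous fun θ : ℝ => gegenbauer lam n (Real.cos θ) :=
  (continuous_gegenbauer lam n).comp Real.continuous_cos

theorem gegenbauerMoment_zero (k : ℕ) (m : ℤ) : gegenbauerMoment k 0 m = sinMoment k m := by
  simp [gegenbauerMoment, sinMoment, gegenbauer]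

theorem gegenbauerMoment_neg (k n : ℕ) (m : ℤ) :
    gegenbauerMoment k n (-m) = gegenbauerMoment k n m := by
  simp [gegenbauerMoment]

theorem two_mul_cos_mul_cos_intCast (i j : ℤ) (θ : ℝ) :
    2 * (Real.cos (i * θ) * Real.cos (j * θ))
      = Real.cos ((i + j : ℤ) * θ) + Real.cos ((i - j : ℤ) * θ) := by
  push_cast
  rw [add_mul, sub_mul, Real.cos_add, Real.cos_sub]
  ring

theorem gegenbauerMoment_one (k : ℕ) (m : ℤ) : gegenbauerMoment k 1 m
    = (k : ℝ) / 2 * (sinMoment k (m + 1) + sinMoment k (m - 1)) := by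
  rw [sinMoment, sinMoment, ← intervalIntegral.integral_add
    (Continuous.intervalIntegrable (by fun_prop) _ _)
    (Continuous.intervalIntegrable (by fun_prop) _ _), ← intervalIntegral.integral_const_mul,
    gegenbauerMoment]
  refine intervalIntegral.integral_congr fun θ _ => ?_
  have h := two_mul_cos_mul_cos_intCast m 1 θ
  simp only [Int.cast_one, one_mul] at h
  simp only [gegenbauer]
  linear_combination (k : ℝ) / 2 * Real.sin θ ^ k * h

theorem gegenbauerMoment_add_two (k n : ℕ) (m : ℤ) :
    ((n : ℝ) + 2) * gegenbauerMoment k (n + 2) m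
      = (n + 1 + (k : ℝ) / 2) * (gegenbauerMoment k (n + 1) (m + 1)
          + gegenbauerMoment k (n + 1) (m - 1)) - (n + k) * gegenbauerMoment k n m := by
  have hc := continuous_gegenbauer_cos ((k : ℝ) / 2)
  have hi : ∀ (n : ℕ) (m : ℤ), IntervalIntegrable (fun θ : ℝ =>
      Real.cos (m * θ) * (gegenbauer ((k : ℝ) / 2) n (Real.cos θ) * Real.sin θ ^ k))
      MeasureTheory.volume 0 π := fun n m => by
    have := hc n
    exact Continuous.intervalIntegrable (by fun_prop) _ _
  simp only [gegenbauerMoment]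
  rw [← intervalIntegral.integral_add (hi _ _) (hi _ _), ← intervalIntegral.integral_const_mul,
    ← intervalIntegral.integral_const_mul, ← intervalIntegral.integral_const_mul,
    ← intervalIntegral.integral_sub (((hi _ _).add (hi _ _)).const_mul _) ((hi _ _).const_mul _)]
  refine intervalIntegral.integral_congr fun θ _ => ?_
  have h := two_mul_cos_mul_cos_intCast m 1 θ
  simp only [Int.cast_one, one_mul] at h
  have hn : (n : ℝ) + 2 ≠ 0 := by positivity
  have hg : ((n : ℝ) + 2) * gegenbauer ((k : ℝ) / 2) (n + 2) (Real.cos θ)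
      = 2 * ((n : ℝ) + 1 + k / 2) * Real.cos θ * gegenbauer ((k : ℝ) / 2) (n + 1) (Real.cos θ)
        - (n + k) * gegenbauer ((k : ℝ) / 2) n (Real.cos θ) := by
    rw [gegenbauer]
    field_simp
  linear_combination ((n : ℝ) + 1 + k / 2)
    * gegenbauer ((k : ℝ) / 2) (n + 1) (Real.cos θ) * Real.sin θ ^ k * h
    + Real.cos (m * θ) * Real.sin θ ^ k * hg

/-- The polynomial factor of the Fourier coefficients of `sin ^ (2 lam) * C_n ^ lam (cos ·)`. -/
noncomputable def polyFactor : ℕ → ℝ → ℝ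
  | 0, _ => 2
  | n + 1, x => (n + 1 + 2 * x) * rising (x + 1) n

/-- What remains of the moment recurrence in `n` once the common Gamma product and the binomial
factors are cancelled. -/
theorem polyFactor_add_two (lam : ℝ) (n : ℕ) (x : ℝ) :
    (2 * lam + n + 1) * polyFactor (n + 2) x
      = (n + 1 + lam) * (-(lam - x) * polyFactor (n + 1) (x + 1)
          + (n + lam + 2 + x) * polyFactor (n + 1) x)
        + (n + 1) * (lam - x) * (n + lam + 2 + x) * polyFactor n (x + 1) := by
  cases n with
  | zero =>
    simp only [polyFactor, rising_succ, rising_zero]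
    push_cast
    ring
  | succ n =>
    have e1 : rising (x + 1) (n + 1) = (x + 1) * rising (x + 1 + 1) n := rising_succ_left _ _
    have e2 := rising_succ (x + 1 + 1) n
    have e3 : rising (x + 1) (n + 1 + 1) = (x + 1) * rising (x + 1 + 1) (n + 1) :=
      rising_succ_left _ _
    simp only [polyFactor, e3, e1, e2]
    push_cast
    ring

theorem gegenbauerMoment_eq (k n : ℕ) (μ : ℤ) :
    gegenbauerMoment k n (n + 2 * μ) = momentConst k * binomCoeff k n
      * polyFactor n μ * gammaKernel ((k : ℝ) / 2) n μ := by
  induction n using Nat.twoStepInduction generalizing μ with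
  | zero =>
    rw [gegenbauerMoment_zero, Nat.cast_zero, zero_add, sinMoment_even]
    simp [binomCoeff_zero, polyFactor]
  | one =>
    rw [gegenbauerMoment_one, show ((1 : ℕ) : ℤ) + 2 * μ + 1 = 2 * (μ + 1) by push_cast; ring,
      show ((1 : ℕ) : ℤ) + 2 * μ - 1 = 2 * μ by push_cast; ring, sinMoment_even, sinMoment_even,
      gammaKernel_succ_right, gammaKernel_eq_mul]
    simp only [binomCoeff, polyFactor, rising_succ, rising_zero, gammaKernel]
    push_cast
    rw [show (1 : ℝ) + k / 2 + 1 + μ = 0 + k / 2 + 2 + μ by ring]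
    simp only [Nat.factorial_one, Nat.cast_one]
    ring
  | more n ih0 ih1 =>
    have h := gegenbauerMoment_add_two k n ((n + 2 : ℕ) + 2 * μ)
    rw [show ((n + 2 : ℕ) : ℤ) + 2 * μ + 1 = (n + 1 : ℕ) + 2 * (μ + 1) by push_cast; ring,
      show ((n + 2 : ℕ) : ℤ) + 2 * μ - 1 = (n + 1 : ℕ) + 2 * μ by push_cast; ring, ih1, ih1,
      show ((n + 2 : ℕ) : ℤ) + 2 * μ = n + 2 * (μ + 1) by push_cast; ring, ih0,
      gammaKernel_succ_right, gammaKernel_succ_right, gammaKernel_eq_mul ((k : ℝ) / 2) (n + 1),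
      inv_Gamma_eq ((n : ℝ) + (k : ℝ) / 2 + 2 + μ)] at h
    rw [show ((n + 2 : ℕ) : ℤ) + 2 * μ = n + 2 * (μ + 1) by push_cast; ring]
    have hp := polyFactor_add_two ((k : ℝ) / 2) n μ
    have hn : (n : ℝ) + 2 ≠ 0 := by positivity
    have e1 := binomCoeff_succ k n
    have e2 := binomCoeff_succ k (n + 1)
    apply mul_left_cancel₀ hn
    push_cast at h e2 ⊢
    rw [h, gammaKernel]
    push_cast
    rw [show (n : ℝ) + 1 + k / 2 + 2 + μ = n + 2 + k / 2 + 1 + μ by ring,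
      show (n : ℝ) + k / 2 + 2 + μ + 1 = n + 2 + k / 2 + 1 + μ by ring]
    -- All three closed forms are polynomial multiples of this product; `e1` and `e2` then relate
    -- the binomial factors, and `hp` the polynomial ones.
    set U := (-1) ^ μ * (Real.Gamma (1 + (k : ℝ) / 2 - μ))⁻¹
      * (Real.Gamma ((n : ℝ) + 2 + k / 2 + 1 + μ))⁻¹ with hU
    linear_combination
      e1 * (momentConst k * polyFactor n (μ + 1) * (-(k / 2 - μ)) * (n + k / 2 + 2 + μ) * U)
      - e2 * momentConst k * polyFactor (n + 2) μ * U
      - hp * binomCoeff k (n + 1) * momentConst k * U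

theorem gegenbauerMoment_odd (k n : ℕ) (μ : ℤ) :
    gegenbauerMoment k n (n + 2 * μ + 1) = 0 := by
  induction n using Nat.twoStepInduction generalizing μ with
  | zero => rw [gegenbauerMoment_zero, Nat.cast_zero, zero_add, sinMoment_odd]
  | one =>
    rw [gegenbauerMoment_one,
      show ((1 : ℕ) : ℤ) + 2 * μ + 1 + 1 = 2 * (μ + 1) + 1 by push_cast; ring,
      show ((1 : ℕ) : ℤ) + 2 * μ + 1 - 1 = 2 * μ + 1 by push_cast; ring, sinMoment_odd,
      sinMoment_odd]
    simp
  | more n ih0 ih1 =>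
    have h := gegenbauerMoment_add_two k n ((n + 2 : ℕ) + 2 * μ + 1)
    rw [show ((n + 2 : ℕ) : ℤ) + 2 * μ + 1 + 1 = (n + 1 : ℕ) + 2 * (μ + 1) + 1 by push_cast; ring,
      show ((n + 2 : ℕ) : ℤ) + 2 * μ + 1 - 1 = (n + 1 : ℕ) + 2 * μ + 1 by push_cast; ring, ih1,
      ih1, show ((n + 2 : ℕ) : ℤ) + 2 * μ + 1 = n + 2 * (μ + 1) + 1 by push_cast; ring, ih0] at h
    rw [show ((n + 2 : ℕ) : ℤ) + 2 * μ + 1 = n + 2 * (μ + 1) + 1 by push_cast; ring]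
    simp only [add_zero, mul_zero, sub_zero] at h
    exact (mul_eq_zero.mp h).resolve_left (by positivity)

theorem rising_neg_eq_zero {i n : ℕ} (h : i < n) : rising (-(i : ℝ)) n = 0 :=
  ascPochhammer_eval_neg_coe_nat_of_lt h

/-- For `j = n + 2μ` the condition means `-n < μ < 0`, and then `(μ+1)(μ+2)⋯(μ+n-1)` contains the
factor zero. -/
theorem gegenbauerMoment_eq_zero_of_lt (k : ℕ) {n : ℕ} {j : ℤ} (hj : |j| < n) :
    gegenbauerMoment k n j = 0 := by
  obtain ⟨h1, h2⟩ := abs_lt.mp hj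
  rcases Int.even_or_odd' (j - n) with ⟨μ, hμ | hμ⟩
  · rw [show j = n + 2 * μ by omega, gegenbauerMoment_eq]
    obtain ⟨n, rfl⟩ : ∃ n', n = n' + 1 := ⟨n - 1, by omega⟩
    obtain ⟨i, hi⟩ : ∃ i : ℕ, μ + 1 = -(i : ℤ) := ⟨(-(μ + 1)).toNat, by omega⟩
    have hi' : (μ : ℝ) + 1 = -(i : ℝ) := by exact_mod_cast hi
    have : polyFactor (n + 1) μ = 0 := by
      rw [polyFactor, hi', rising_neg_eq_zero (by omega), mul_zero]
    rw [this, mul_zero, zero_mul]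
  · rw [show j = n + 2 * μ + 1 by omega, gegenbauerMoment_odd]

/-! ### Absolute summability of the moments. -/

/-- With `a_s` the moment at `2s`, the recurrence gives `k|a_s| = (s + k/2)|a_s| - (s + 1 +
k/2)|a_{s+1}|` for `s ≥ k/2`, so the partial sums telescope and stay bounded. -/
theorem summable_sinMoment_two_mul {k : ℕ} (hk : 0 < k) :
    Summable fun s : ℕ => sinMoment k (2 * s) := by
  have hrec : ∀ s : ℕ, ((k : ℝ) / 2 + s + 1) * sinMoment k (2 * (s + 1 : ℕ))
      = (s - (k : ℝ) / 2) * sinMoment k (2 * s) := fun s => by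
    have h := sinMoment_add_two k (2 * s)
    rw [show 2 * ((s + 1 : ℕ) : ℤ) = 2 * s + 2 by push_cast; ring]
    push_cast at h
    linear_combination h / 2
  -- Starting at `s = k` makes the factor `s - k/2` non-negative.
  rw [← summable_nat_add_iff k]
  refine Summable.of_norm (summable_of_sum_range_le (c := (k : ℝ)⁻¹ *
    ((k + (k : ℝ) / 2) * |sinMoment k (2 * k)|)) (fun _ => norm_nonneg _) fun N => ?_)
  have hkpos : (0 : ℝ) < k := by exact_mod_cast hk
  have tele : ∑ s ∈ Finset.range N, ‖sinMoment k (2 * ((s + k : ℕ) : ℤ))‖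
      = (k : ℝ)⁻¹ * ((k + (k : ℝ) / 2) * |sinMoment k (2 * k)|
        - (N + k + (k : ℝ) / 2) * |sinMoment k (2 * ((N + k : ℕ) : ℤ))|) := by
    induction N with
    | zero => simp
    | succ N ih =>
      have h := congrArg abs (hrec (N + k))
      have h1 : (0 : ℝ) ≤ (k : ℝ) / 2 + (N + k : ℕ) + 1 := by positivity
      have h2 : (0 : ℝ) ≤ (N + k : ℕ) - (k : ℝ) / 2 := by
        push_cast
        linarith [(Nat.cast_nonneg N : (0 : ℝ) ≤ N)]
      rw [abs_mul, abs_mul, abs_of_nonneg h1, abs_of_nonneg h2] at h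
      rw [Finset.sum_range_succ, ih, Real.norm_eq_abs, show N + 1 + k = N + k + 1 by ring]
      push_cast at h ⊢
      field_simp
      linarith
  rw [tele]
  gcongr
  have : 0 ≤ (N + k + (k : ℝ) / 2) * |sinMoment k (2 * ((N + k : ℕ) : ℤ))| := by positivity
  linarith

theorem summable_sinMoment {k : ℕ} (hk : 0 < k) : Summable (sinMoment k) := by
  have h : Summable fun m : ℕ => sinMoment k m := by
    refine Summable.even_add_odd ?_ ?_
    · simpa using summable_sinMoment_two_mul hk
    · refine summable_zero.congr fun s => ?_
      have := sinMoment_odd k s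
      push_cast
      exact this.symm
  exact h.of_nat_of_neg (by simpa only [sinMoment_neg] using h)

theorem gegenbauerMoment_eq_sum (k n : ℕ) (m : ℤ) :
    gegenbauerMoment k n m = ∑ p ∈ Finset.HasAntidiagonal.antidiagonal n,
      binomCoeff ((k : ℝ) / 2) p.1 * binomCoeff ((k : ℝ) / 2) p.2 / 2
        * (sinMoment k (m + (p.1 - p.2)) + sinMoment k (m - (p.1 - p.2))) := by
  have hi : ∀ m : ℤ, IntervalIntegrable (fun θ : ℝ => Real.cos (m * θ) * Real.sin θ ^ k)
      MeasureTheory.volume 0 π := fun m => Continuous.intervalIntegrable (by fun_prop) _ _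
  simp only [sinMoment]
  simp_rw [← intervalIntegral.integral_add (hi _) (hi _), ← intervalIntegral.integral_const_mul]
  rw [← intervalIntegral.integral_finsetSum fun p _ => ((hi _).add (hi _)).const_mul _,
    gegenbauerMoment]
  refine intervalIntegral.integral_congr fun θ _ => ?_
  simp only [gegenbauer_cos, Finset.sum_mul, Finset.mul_sum]
  refine Finset.sum_congr rfl fun p _ => ?_
  have h := two_mul_cos_mul_cos_intCast m (p.1 - p.2) θ
  linear_combination binomCoeff ((k : ℝ) / 2) p.1 * binomCoeff ((k : ℝ) / 2) p.2 / 2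
    * Real.sin θ ^ k * h

theorem summable_gegenbauerMoment {k : ℕ} (hk : 0 < k) (n : ℕ) :
    Summable (gegenbauerMoment k n) := by
  have h := summable_sinMoment hk
  rw [funext (gegenbauerMoment_eq_sum k n)]
  refine summable_sum (f := fun (p : ℕ × ℕ) (m : ℤ) =>
    binomCoeff ((k : ℝ) / 2) p.1 * binomCoeff ((k : ℝ) / 2) p.2 / 2
      * (sinMoment k (m + (p.1 - p.2)) + sinMoment k (m - (p.1 - p.2)))) fun p _ => ?_
  exact ((h.comp_injective (add_left_injective ((p.1 : ℤ) - p.2))).add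
    (h.comp_injective (sub_left_injective (b := (p.1 : ℤ) - p.2)))).mul_left _

/-! ### Cosine series and term-by-term integration. -/

/-- A continuous function on `[0, π]` with summable cosine coefficients is the sum of its cosine
series. -/
theorem hasSum_cosine_series {g : ℝ → ℝ} (hg : Continuous g)
    (hs : Summable fun m : ℤ => ∫ θ in (0 : ℝ)..π, Real.cos (m * θ) * g θ)
    {θ : ℝ} (hθ : θ ∈ Icc 0 π) :
    HasSum (fun m : ℤ => (∫ θ in (0 : ℝ)..π, Real.cos (m * θ) * g θ) / π * Real.cos (m * θ))
      (g θ) := by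
  have : Fact (0 < 2 * π) := ⟨by positivity⟩
  -- Composition with `arccos ∘ cos` is the even, `2π`-periodic, continuous extension of `g` from
  -- `[0, π]`.
  set H : ℝ → ℂ := fun x => (g (Real.arccos (Real.cos x)) : ℂ) with hH
  have hHc : Continuous H :=
    Complex.continuous_ofReal.comp (hg.comp (Real.continuous_arccos.comp Real.continuous_cos))
  have hHp : Function.Periodic H (2 * π) := fun x => by simp only [hH, Real.cos_add_two_pi]
  have hHn : ∀ x, H (-x) = H x := fun x => by simp only [hH, Real.cos_neg]
  have hHe : ∀ x ∈ Icc 0 π, H x = g x := fun x hx => by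
    simp only [hH, Real.arccos_cos hx.1 hx.2]
  let f : C(AddCircle (2 * π), ℂ) := ⟨hHp.lift, continuous_coinduced_dom.mpr hHc⟩
  have hf : ∀ x : ℝ, f x = H x := fun x => rfl
  have hfour : ∀ (m : ℤ) (x : ℝ),
      @fourier (2 * π) m (x : AddCircle (2 * π)) = Complex.exp (m * x * Complex.I) := by
    intro m x
    rw [fourier_coe_apply]
    congr 1
    have : (π : ℂ) ≠ 0 := by exact_mod_cast Real.pi_ne_zero
    push_cast
    field_simp
  have hcoeff : ∀ m : ℤ, fourierCoeff f m
      = (((∫ θ in (0 : ℝ)..π, Real.cos (m * θ) * g θ) / π : ℝ) : ℂ) := by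
    intro m
    set F : ℝ → ℂ := fun x => Complex.exp (-(m * x * Complex.I)) * H x with hF
    have hFc : Continuous F := by fun_prop
    have hFn : Continuous fun x => F (-x) := hFc.comp continuous_neg
    have hFi : ∀ a b, IntervalIntegrable F MeasureTheory.volume a b :=
      fun a b => hFc.intervalIntegrable a b
    have e1 : fourierCoeff f m = (1 / (2 * π)) • ∫ x in (-π)..π, F x := by
      rw [fourierCoeff_eq_intervalIntegral f m (-π), show -π + 2 * π = π by ring]
      congr 1
      refine intervalIntegral.integral_congr fun x _ => ?_
      simp only [hfour, hf, smul_eq_mul, hF]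
      push_cast
      ring_nf
    have e2 : ∫ x in (-π)..0, F x = ∫ x in (0 : ℝ)..π, F (-x) := by
      rw [intervalIntegral.integral_comp_neg, neg_zero]
    have e3 : ∫ x in (-π)..π, F x
        = ∫ x in (0 : ℝ)..π, ((2 * (Real.cos (m * x) * g x) : ℝ) : ℂ) := by
      rw [← intervalIntegral.integral_add_adjacent_intervals (hFi _ 0) (hFi 0 _), e2,
        ← intervalIntegral.integral_add (hFn.intervalIntegrable 0 π) (hFi _ _)]
      refine intervalIntegral.integral_congr fun x hx => ?_
      rw [uIcc_of_le Real.pi_pos.le] at hx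
      simp only [hF, hHn, hHe x hx]
      push_cast
      rw [Complex.cos]
      ring_nf
    rw [e1, e3, intervalIntegral.integral_ofReal, intervalIntegral.integral_const_mul,
      Complex.real_smul, ← Complex.ofReal_mul]
    congr 1
    field_simp
  have hsum : Summable (fourierCoeff f) := by
    rw [funext hcoeff]
    exact Complex.summable_ofReal.mpr (hs.div_const _)
  have h := Complex.hasSum_re (has_pointwise_sum_fourier_series_of_summable hsum (θ : AddCircle _))
  rw [hf, hHe θ hθ, Complex.ofReal_re] at h
  refine h.congr_fun fun m => ?_
  rw [hcoeff, hfour, smul_eq_mul, Complex.re_ofReal_mul]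
  congr 1
  rw [show (m : ℂ) * θ * Complex.I = ((m * θ : ℝ) : ℂ) * Complex.I by push_cast; ring,
    Complex.exp_ofReal_mul_I_re]

/-- Term-by-term integration of a series `∑ c_i u_i` with `|u_i| ≤ 1` and `c` summable. -/
theorem hasSum_integral_series_mul {ι : Type*} [Countable ι] {c : ι → ℝ} {u : ι → ℝ → ℝ}
    {g ψ : ℝ → ℝ} (hψ : ContinuousOn ψ (Icc 0 π)) (hc : Summable c)
    (hu : ∀ i, Continuous (u i)) (hu1 : ∀ i θ, |u i θ| ≤ 1)
    (hsum : ∀ θ ∈ Icc (0 : ℝ) π, HasSum (fun i => c i * u i θ) (g θ)) :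
    HasSum (fun i => c i * ∫ θ in (0 : ℝ)..π, u i θ * ψ θ) (∫ θ in (0 : ℝ)..π, g θ * ψ θ) := by
  have hsub : uIoc (0 : ℝ) π ⊆ Icc 0 π := by
    rw [uIoc_of_le Real.pi_pos.le]
    exact Ioc_subset_Icc_self
  have h := intervalIntegral.hasSum_integral_of_dominated_convergence
    (μ := MeasureTheory.volume) (a := 0) (b := π) (F := fun i θ => c i * (u i θ * ψ θ))
    (f := fun θ => g θ * ψ θ) (fun i θ => |c i| * |ψ θ|) (fun i => ?_) (fun i => ?_) ?_ ?_ ?_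
  · simpa only [intervalIntegral.integral_const_mul] using h
  · exact (((continuous_const.mul (hu i)).continuousOn.mul hψ).mono hsub
      |>.aestronglyMeasurable measurableSet_uIoc).congr (MeasureTheory.ae_of_all _ fun θ => by
        simp only [Pi.mul_apply]; ring)
  · refine MeasureTheory.ae_of_all _ fun θ _ => ?_
    rw [Real.norm_eq_abs, abs_mul, abs_mul]
    exact mul_le_mul_of_nonneg_left (mul_le_of_le_one_left (abs_nonneg _) (hu1 i θ)) (abs_nonneg _)
  · exact MeasureTheory.ae_of_all _ fun θ _ => hc.abs.mul_right _
  · simp_rw [tsum_mul_right]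
    refine ContinuousOn.intervalIntegrable ?_
    rw [uIcc_of_le Real.pi_pos.le]
    exact continuousOn_const.mul hψ.abs
  · refine MeasureTheory.ae_of_all _ fun θ hθ => ?_
    simpa only [mul_assoc] using (hsum θ (hsub hθ)).mul_right (ψ θ)

/-! ### Matching the constants with the stated coefficients. -/

theorem rising_natCast_add_one (n j : ℕ) :
    rising ((n : ℝ) + 1) j * n.factorial = (n + j).factorial := by
  induction j with
  | zero => simp [rising_zero]
  | succ j ih =>
    rw [rising_succ, ← add_assoc, Nat.factorial_succ]
    push_cast
    linear_combination ((n : ℝ) + 1 + j) * ih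

theorem polyFactor_zero_right {n : ℕ} (hn : n ≠ 0) : polyFactor n 0 = n.factorial := by
  obtain ⟨n, rfl⟩ := Nat.exists_eq_succ_of_ne_zero hn
  have h := rising_natCast_add_one 0 n
  simp only [Nat.cast_zero, Nat.factorial_zero, Nat.cast_one, mul_one, zero_add] at h
  rw [Nat.succ_eq_add_one, polyFactor, zero_add, h, Nat.factorial_succ]
  push_cast
  ring

/-- Exchanges the roles of `n` and `μ = j + 1`: for `n ≥ 1`, `μ! (μ+1)_{n-1}` and `n! (n+1)_{μ-1}`
both equal `(n+μ-1)!`. -/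
theorem polyFactor_natCast_succ (n j : ℕ) :
    polyFactor n ((j : ℝ) + 1) * (j + 1).factorial
      = n.factorial * rising ((n : ℝ) + 1) j * ((n : ℝ) + 2 * (j + 1)) := by
  have h1 := rising_natCast_add_one n j
  cases n with
  | zero =>
    simp only [polyFactor, Nat.factorial_succ, Nat.cast_zero, Nat.factorial_zero,
      zero_add, mul_one, Nat.cast_one] at h1 ⊢
    rw [h1]
    push_cast
    ring
  | succ n =>
    have h2 := rising_natCast_add_one (j + 1) n
    rw [show j + 1 + n = n + 1 + j by ring, ← h1] at h2
    simp only [polyFactor]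
    push_cast at h2 ⊢
    linear_combination ((n : ℝ) + 1 + 2 * (j + 1)) * h2

theorem Gamma_add_natCast {x : ℝ} (hx : 0 < x) (m : ℕ) :
    Real.Gamma (x + m) = rising x m * Real.Gamma x := by
  induction m with
  | zero => simp [rising_zero]
  | succ m ih =>
    rw [Nat.cast_succ, ← add_assoc, Real.Gamma_add_one (by positivity), ih, rising_succ]
    ring

theorem neg_one_pow_mul_inv_Gamma (lam : ℝ) (m : ℕ) :
    (-1) ^ m * (Real.Gamma (1 + lam - m))⁻¹ = rising (-lam) m * (Real.Gamma (1 + lam))⁻¹ := by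
  induction m with
  | zero => simp [rising_zero]
  | succ m ih =>
    rw [rising_succ, Nat.cast_succ, show 1 + lam - ((m : ℝ) + 1) = lam - m by ring,
      inv_Gamma_eq (lam - m), show lam - (m : ℝ) + 1 = 1 + lam - m by ring, pow_succ]
    linear_combination (-lam + m) * ih

theorem gammaKernel_natCast {lam : ℝ} (hlam : 0 < lam) (n m : ℕ) :
    gammaKernel lam n m = rising (-lam) m / (Real.Gamma (1 + lam)
      * (rising ((n : ℝ) + lam + 1) m * Real.Gamma (n + lam + 1))) := by
  rw [← Gamma_add_natCast (by positivity), gammaKernel, zpow_natCast, Int.cast_natCast,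
    neg_one_pow_mul_inv_Gamma, div_eq_mul_inv, mul_inv]
  ring

/-- Legendre's duplication formula removes `√π`, `2^(2λ)` and `Γ(λ + 1/2)`. -/
theorem leadFactor_eq {lam : ℝ} (hlam : 0 < lam) (n : ℕ) :
    leadFactor lam n
      = Real.Gamma lam * rising (2 * lam) n / (2 * Real.Gamma (n + lam)) := by
  have hdup := Real.Gamma_mul_Gamma_add_half lam
  have h1 : Real.Gamma (lam + 1 / 2) ≠ 0 := (Real.Gamma_pos_of_pos (by positivity)).ne'
  have h2 : Real.Gamma (n + lam) ≠ 0 := (Real.Gamma_pos_of_pos (by positivity)).ne'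
  have h3 : (2 : ℝ) ^ (2 * lam) ≠ 0 := by positivity
  rw [Real.rpow_sub (by norm_num), Real.rpow_one] at hdup
  rw [leadFactor, add_comm (n : ℝ) (2 * lam), Gamma_add_natCast (by positivity)]
  generalize rising (2 * lam) n = r
  field_simp at hdup ⊢
  linear_combination (-r) * hdup

theorem leadFactor_pos {lam : ℝ} (hlam : 0 < lam) (n : ℕ) : 0 < leadFactor lam n := by
  rw [leadFactor_eq hlam]
  have h1 := Real.Gamma_pos_of_pos hlam
  have h2 : 0 < Real.Gamma (n + lam) := Real.Gamma_pos_of_pos (by positivity)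
  have h3 := rising_pos (x := 2 * lam) (by positivity) n
  positivity

/-- The normalisation of the integral defining the `d`-Schoenberg coefficients. -/
noncomputable def schoenbergConst (lam : ℝ) (n : ℕ) : ℝ :=
  ((n : ℝ) + lam) * Real.Gamma lam / (Real.Gamma (lam + 1 / 2) * Real.Gamma (1 / 2))

theorem schoenbergConst_mul_gegenbauerMoment {k : ℕ} (hk : 0 < k) (n m : ℕ) :
    schoenbergConst ((k : ℝ) / 2) n * gegenbauerMoment k n (n + 2 * m)
      = leadFactor ((k : ℝ) / 2) n * (polyFactor n m * rising (-((k : ℝ) / 2)) m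
        / (n.factorial * rising ((n : ℝ) + k / 2 + 1) m)) := by
  have hlam : (0 : ℝ) < (k : ℝ) / 2 := by positivity
  have h1 : Real.Gamma ((k : ℝ) / 2 + 1 / 2) ≠ 0 := (Real.Gamma_pos_of_pos (by positivity)).ne'
  have h2 : Real.Gamma (n + (k : ℝ) / 2) ≠ 0 := (Real.Gamma_pos_of_pos (by positivity)).ne'
  have h3 : Real.Gamma ((k : ℝ) / 2 + 1) ≠ 0 := (Real.Gamma_pos_of_pos (by positivity)).ne'
  have h4 : rising ((n : ℝ) + k / 2 + 1) m ≠ 0 := (rising_pos (by positivity) m).ne'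
  have h5 : (n : ℝ) + k / 2 ≠ 0 := by positivity
  have h6 : √π ≠ 0 := by positivity
  have h7 : Real.Gamma (n + (k : ℝ) / 2 + 1) = (n + (k : ℝ) / 2) * Real.Gamma (n + (k : ℝ) / 2) :=
    Real.Gamma_add_one h5
  rw [gegenbauerMoment_eq, Int.cast_natCast, gammaKernel_natCast hlam, leadFactor_eq hlam, h7,
    schoenbergConst, momentConst, binomCoeff, Real.Gamma_one_half_eq, add_comm (1 : ℝ),
    show 2 * ((k : ℝ) / 2) = k by ring]
  set x := (k : ℝ) / 2
  field_simp

theorem schoenbergConst_mul_gegenbauerMoment_self {k n : ℕ} (hk : 0 < k) (hn : n ≠ 0) :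
    schoenbergConst ((k : ℝ) / 2) n * gegenbauerMoment k n n = leadFactor ((k : ℝ) / 2) n := by
  have h := schoenbergConst_mul_gegenbauerMoment hk n 0
  have hf : (n.factorial : ℝ) ≠ 0 := by positivity
  simpa [rising_zero, polyFactor_zero_right hn, hf] using h

/-- Twice `leadFactor` at `n = 0`, because `polyFactor 0` is `2`, not `0!`. -/
theorem schoenbergConst_mul_gegenbauerMoment_zero {k : ℕ} (hk : 0 < k) :
    schoenbergConst ((k : ℝ) / 2) 0 * gegenbauerMoment k 0 0 = 1 := by
  have hG : Real.Gamma ((k : ℝ) / 2) ≠ 0 := (Real.Gamma_pos_of_pos (by positivity)).ne'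
  have h := schoenbergConst_mul_gegenbauerMoment hk 0 0
  rw [leadFactor_eq (by positivity)] at h
  simp [rising_zero, polyFactor] at h ⊢
  rw [h]
  field_simp

theorem leadFactor_zero {lam : ℝ} (hlam : 0 < lam) : leadFactor lam 0 = 1 / 2 := by
  have hG : Real.Gamma lam ≠ 0 := (Real.Gamma_pos_of_pos hlam).ne'
  rw [leadFactor_eq hlam, rising_zero, Nat.cast_zero, zero_add]
  field_simp

/-- The splitting `(-λ)_μ = -λ (1-λ)_{μ-1}` produces the factor `-λ` in front of the series. -/
theorem schoenbergConst_mul_gegenbauerMoment_succ {k : ℕ} (hk : 0 < k) (n j : ℕ) :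
    schoenbergConst ((k : ℝ) / 2) n * gegenbauerMoment k n (n + 2 * (j + 1 : ℕ))
      = -(leadFactor ((k : ℝ) / 2) n * ((k : ℝ) / 2)) * seriesCoeff ((k : ℝ) / 2) n (j + 1) := by
  have hp := polyFactor_natCast_succ n j
  have h4 : rising ((n : ℝ) + k / 2 + 1) (j + 1) ≠ 0 := (rising_pos (by positivity) _).ne'
  have hf : (n.factorial : ℝ) ≠ 0 := by positivity
  have hj : ((j + 1).factorial : ℝ) ≠ 0 := by positivity
  rw [schoenbergConst_mul_gegenbauerMoment hk, rising_succ_left (-((k : ℝ) / 2)), seriesCoeff,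
    Nat.add_sub_cancel, neg_add_eq_sub]
  push_cast
  rw [← eq_div_iff hj] at hp
  rw [hp]
  field_simp

/-- Here `k` stands for `λ` itself, not for `2λ`. -/
theorem seriesCoeff_eq_zero_of_lt {k n m : ℕ} (hk : 0 < k) (hm : k < m) :
    seriesCoeff k n m = 0 := by
  have h : rising (1 - (k : ℝ)) (m - 1) = 0 := by
    rw [show 1 - (k : ℝ) = -((k - 1 : ℕ) : ℝ) by rw [Nat.cast_sub hk]; push_cast; ring]
    exact rising_neg_eq_zero (by omega)
  rw [seriesCoeff, h]
  simp

/-! ### Orthogonality and uniqueness of the Schoenberg sequence. -/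

theorem abs_gegenbauer_cos_div_le {lam : ℝ} (hlam : 0 < lam) (n : ℕ) (θ : ℝ) :
    |gegenbauer lam n (Real.cos θ) / gegenbauer lam n 1| ≤ 1 := by
  have h := gegenbauer_one_pos hlam n
  rw [abs_div, abs_of_pos h, div_le_one h]
  exact abs_gegenbauer_cos_le hlam n θ

theorem integral_gegenbauer_mul_gegenbauer (k m n : ℕ) :
    ∫ θ in (0 : ℝ)..π, gegenbauer ((k : ℝ) / 2) m (Real.cos θ)
        * (gegenbauer ((k : ℝ) / 2) n (Real.cos θ) * Real.sin θ ^ k)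
      = ∑ p ∈ Finset.HasAntidiagonal.antidiagonal m, binomCoeff ((k : ℝ) / 2) p.1
        * binomCoeff ((k : ℝ) / 2) p.2 * gegenbauerMoment k n (p.1 - p.2) := by
  have hc := continuous_gegenbauer_cos ((k : ℝ) / 2) n
  simp only [gegenbauerMoment, ← intervalIntegral.integral_const_mul]
  rw [← intervalIntegral.integral_finsetSum fun p _ =>
    Continuous.intervalIntegrable (by fun_prop) _ _]
  refine intervalIntegral.integral_congr fun θ _ => ?_
  simp only [gegenbauer_cos _ m, Finset.sum_mul, mul_assoc]

theorem integral_gegenbauer_mul_gegenbauer_of_lt (k : ℕ) {m n : ℕ} (h : m < n) :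
    ∫ θ in (0 : ℝ)..π, gegenbauer ((k : ℝ) / 2) m (Real.cos θ)
        * (gegenbauer ((k : ℝ) / 2) n (Real.cos θ) * Real.sin θ ^ k) = 0 := by
  rw [integral_gegenbauer_mul_gegenbauer]
  refine Finset.sum_eq_zero fun p hp => ?_
  have := Finset.HasAntidiagonal.mem_antidiagonal.mp hp
  rw [gegenbauerMoment_eq_zero_of_lt k (by rw [abs_lt]; constructor <;> omega), mul_zero]

theorem integral_gegenbauer_mul_gegenbauer_of_ne (k : ℕ) {m n : ℕ} (h : m ≠ n) :
    ∫ θ in (0 : ℝ)..π, gegenbauer ((k : ℝ) / 2) m (Real.cos θ)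
        * (gegenbauer ((k : ℝ) / 2) n (Real.cos θ) * Real.sin θ ^ k) = 0 := by
  rcases h.lt_or_gt with h | h
  · exact integral_gegenbauer_mul_gegenbauer_of_lt k h
  · simpa only [mul_left_comm] using integral_gegenbauer_mul_gegenbauer_of_lt k h

/-- Of the frequencies in one factor `C_n^λ(cos θ)`, only `±n` have a possibly nonzero moment. They
are distinct for `n ≠ 0`, whence the factor 2. -/
theorem integral_gegenbauer_mul_self (k : ℕ) {n : ℕ} (hn : n ≠ 0) :
    ∫ θ in (0 : ℝ)..π, gegenbauer ((k : ℝ) / 2) n (Real.cos θ)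
        * (gegenbauer ((k : ℝ) / 2) n (Real.cos θ) * Real.sin θ ^ k)
      = 2 * binomCoeff ((k : ℝ) / 2) n * gegenbauerMoment k n n := by
  rw [integral_gegenbauer_mul_gegenbauer]
  have hne : ((n, 0) : ℕ × ℕ) ≠ (0, n) := fun h => hn (Prod.ext_iff.mp h).1
  have hsub : ({(n, 0), (0, n)} : Finset (ℕ × ℕ)) ⊆ Finset.HasAntidiagonal.antidiagonal n := by
    intro p hp
    rcases Finset.mem_insert.mp hp with rfl | hp
    · simp
    · simp [Finset.mem_singleton.mp hp]
  rw [← Finset.sum_subset hsub fun p hp hp' => ?_, Finset.sum_pair hne]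
  · simp only [Nat.cast_zero, sub_zero, zero_sub, gegenbauerMoment_neg, binomCoeff_zero]
    ring
  · have hs := Finset.HasAntidiagonal.mem_antidiagonal.mp hp
    simp only [Finset.mem_insert, Finset.mem_singleton, Prod.ext_iff, not_or] at hp'
    rw [gegenbauerMoment_eq_zero_of_lt k (by rw [abs_lt]; constructor <;> omega), mul_zero]

theorem schoenbergConst_mul_integral_gegenbauer_sq {k : ℕ} (hk : 0 < k) (n : ℕ) :
    schoenbergConst ((k : ℝ) / 2) n * ∫ θ in (0 : ℝ)..π, gegenbauer ((k : ℝ) / 2) n (Real.cos θ)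
        * (gegenbauer ((k : ℝ) / 2) n (Real.cos θ) * Real.sin θ ^ k)
      = gegenbauer ((k : ℝ) / 2) n 1 := by
  rcases eq_or_ne n 0 with rfl | hn
  · rw [integral_gegenbauer_mul_gegenbauer]
    simpa [binomCoeff_zero, gegenbauer] using schoenbergConst_mul_gegenbauerMoment_zero hk
  · have hlam : (0 : ℝ) < (k : ℝ) / 2 := by positivity
    have hG : Real.Gamma ((k : ℝ) / 2) ≠ 0 := (Real.Gamma_pos_of_pos hlam).ne'
    have hr : rising ((k : ℝ) / 2) n ≠ 0 := (rising_pos hlam n).ne'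
    rw [integral_gegenbauer_mul_self k hn, mul_left_comm,
      schoenbergConst_mul_gegenbauerMoment_self hk hn, leadFactor_eq hlam, gegenbauer_apply_one,
      add_comm (n : ℝ), Gamma_add_natCast hlam, binomCoeff]
    field_simp

theorem schoenbergCoeff_eq (k : ℕ) (ψ : ℝ → ℝ) (n : ℕ) :
    schoenbergCoeff (k + 1) ψ n = schoenbergConst ((k : ℝ) / 2) n * ∫ θ in (0 : ℝ)..π,
      gegenbauer ((k : ℝ) / 2) n (Real.cos θ) * Real.sin θ ^ k * ψ θ := by
  simp only [schoenbergCoeff, lamOf, schoenbergConst, Nat.cast_succ, add_sub_cancel_right,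
    Nat.add_sub_cancel]
  congr 2
  ext θ
  ring

theorem IsSchoenbergSeq.eq_schoenbergCoeff {k : ℕ} (hk : 0 < k) {ψ : ℝ → ℝ} {b : ℕ → ℝ}
    (hb : IsSchoenbergSeq (k + 1) ψ b) (n : ℕ) : b n = schoenbergCoeff (k + 1) ψ n := by
  obtain ⟨-, hb1, hsum⟩ := hb
  have hlam : (0 : ℝ) < (k : ℝ) / 2 := by positivity
  have hd : lamOf (k + 1) = (k : ℝ) / 2 := by simp [lamOf]
  rw [hd] at hsum
  have hc := continuous_gegenbauer_cos ((k : ℝ) / 2)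
  have hcn := hc n
  -- Here `ψ` is the function being expanded, and the fixed factor is `C_n^λ(cos θ) sin^k θ`.
  have h := hasSum_integral_series_mul
    (ψ := fun θ => gegenbauer ((k : ℝ) / 2) n (Real.cos θ) * Real.sin θ ^ k)
    (Continuous.continuousOn (by fun_prop)) hb1.summable (fun i => (hc i).div_const _)
    (fun i θ => abs_gegenbauer_cos_div_le hlam i θ) hsum
  simp only [div_mul_eq_mul_div, intervalIntegral.integral_div] at h
  have h1 := h.unique (hasSum_single n fun m hm => by
    rw [integral_gegenbauer_mul_gegenbauer_of_ne k hm]; simp)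
  have hpos := gegenbauer_one_pos hlam n
  have h2 : schoenbergCoeff (k + 1) ψ n = schoenbergConst ((k : ℝ) / 2) n
      * ∫ θ in (0 : ℝ)..π, ψ θ * (gegenbauer ((k : ℝ) / 2) n (Real.cos θ) * Real.sin θ ^ k) := by
    rw [schoenbergCoeff_eq]
    simp only [mul_comm (ψ _)]
  rw [h2, h1, mul_left_comm, ← mul_div_assoc, schoenbergConst_mul_integral_gegenbauer_sq hk,
    div_self hpos.ne', mul_one]

/-! ### The series in the 1-Schoenberg coefficients. -/

theorem circleCoeff_of_ne {n : ℕ} (hn : n ≠ 0) (ψ : ℝ → ℝ) :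
    circleCoeff ψ n = 2 / π * ∫ θ in (0 : ℝ)..π, Real.cos (n * θ) * ψ θ := by
  rw [circleCoeff, if_neg hn]
  simp only [mul_comm (ψ _)]

theorem circleCoeffStar_eq (ψ : ℝ → ℝ) (n : ℕ) :
    circleCoeffStar ψ n = 2 / π * ∫ θ in (0 : ℝ)..π, Real.cos (n * θ) * ψ θ := by
  rcases eq_or_ne n 0 with rfl | hn
  · simp [circleCoeffStar, circleCoeff]
    ring
  · rw [circleCoeffStar, if_neg hn, circleCoeff_of_ne hn]

theorem hasSum_seriesCoeff_mul_circleCoeff {k : ℕ} (hk : 0 < k) {ψ : ℝ → ℝ}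
    (hψ : ContinuousOn ψ (Icc 0 π)) (n : ℕ) :
    HasSum (fun j : ℕ => -(leadFactor ((k : ℝ) / 2) n * ((k : ℝ) / 2))
        * (seriesCoeff ((k : ℝ) / 2) n (j + 1) * circleCoeff ψ (n + 2 * (j + 1))))
      (schoenbergCoeff (k + 1) ψ n - leadFactor ((k : ℝ) / 2) n * circleCoeffStar ψ n) := by
  have hlam : (0 : ℝ) < (k : ℝ) / 2 := by positivity
  have hc := continuous_gegenbauer_cos ((k : ℝ) / 2) n
  set C := schoenbergConst ((k : ℝ) / 2) n with hC
  set B : ℤ → ℝ := fun m => ∫ θ in (0 : ℝ)..π, Real.cos (m * θ) * ψ θ with hB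
  set f : ℤ → ℝ := fun m => C * (gegenbauerMoment k n m / π * B m) with hf
  have hfn : ∀ m, f (-m) = f m := fun m => by simp [hf, hB, gegenbauerMoment_neg]
  have hS : HasSum f (schoenbergCoeff (k + 1) ψ n) := by
    rw [schoenbergCoeff_eq]
    have hs := summable_gegenbauerMoment hk n
    exact (hasSum_integral_series_mul hψ (hs.div_const π) (fun m => by fun_prop)
      (fun m θ => Real.abs_cos_le_one (m * θ)) fun θ hθ =>
        hasSum_cosine_series (by fun_prop) hs hθ).mul_left C
  -- Folding the sum over `ℤ` onto `ℕ` counts the frequency `0` twice, hence the extra `f 0`.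
  have hN : HasSum (fun m : ℕ => 2 * f m) (schoenbergCoeff (k + 1) ψ n + f 0) := by
    simpa only [hfn, ← two_mul] using hS.nat_add_neg
  have hinj : Function.Injective fun j : ℕ => n + 2 * j := fun i j h => by
    simp only at h
    omega
  have hM : HasSum (fun j : ℕ => 2 * f (n + 2 * j)) (schoenbergCoeff (k + 1) ψ n + f 0) := by
    have := (hinj.hasSum_iff (f := fun m : ℕ => 2 * f m) fun m hm => ?_).mpr hN
    · simpa [Function.comp_def] using this
    · have : gegenbauerMoment k n m = 0 := by
        rcases lt_or_ge m n with h | h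
        · exact gegenbauerMoment_eq_zero_of_lt k (by rw [abs_of_nonneg (by positivity)]; omega)
        · rcases Nat.even_or_odd' (m - n) with ⟨j, hj | hj⟩
          · exact absurd ⟨j, by simp only; omega⟩ hm
          · rw [show (m : ℤ) = n + 2 * j + 1 by omega, gegenbauerMoment_odd]
      simp [hf, this]
  have hT := (hasSum_nat_add_iff' 1).mpr hM
  -- For `n ≥ 1`, `f 0` vanishes and the removed term is `2 f(n)`. For `n = 0`, the removed `2 f(0)`
  -- is half offset by the extra `f 0`; this agrees with `leadFactor = 1/2` and the doubled
  -- `b_{0,1}^*`.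
  have hlead : schoenbergCoeff (k + 1) ψ n + f 0 - ∑ i ∈ Finset.range 1, 2 * f (n + 2 * i)
      = schoenbergCoeff (k + 1) ψ n - leadFactor ((k : ℝ) / 2) n * circleCoeffStar ψ n := by
    rw [Finset.sum_range_one, circleCoeffStar_eq]
    rcases eq_or_ne n 0 with rfl | hn
    · have h0 := schoenbergConst_mul_gegenbauerMoment_zero hk
      rw [leadFactor_zero hlam]
      simp only [hf, hB, Nat.cast_zero, mul_zero, add_zero, Int.cast_zero]
      linear_combination (-(∫ θ in (0 : ℝ)..π, Real.cos (0 * θ) * ψ θ) / π) * h0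
    · have h0 := schoenbergConst_mul_gegenbauerMoment_self hk hn
      have hz : gegenbauerMoment k n 0 = 0 :=
        gegenbauerMoment_eq_zero_of_lt k (by simpa using Nat.pos_of_ne_zero hn)
      simp only [hf, hB, hz, Nat.cast_zero, mul_zero, add_zero, zero_div, zero_mul,
        Int.cast_natCast]
      linear_combination (-2 * (∫ θ in (0 : ℝ)..π, Real.cos (n * θ) * ψ θ) / π) * h0
  rw [hlead] at hT
  refine hT.congr_fun fun j => ?_
  have hj := schoenbergConst_mul_gegenbauerMoment_succ hk n j
  rw [circleCoeff_of_ne (by omega)]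
  simp only [hf, hB]
  push_cast at hj ⊢
  linear_combination (-2 * (∫ θ in (0 : ℝ)..π, Real.cos ((n + 2 * (j + 1)) * θ) * ψ θ) / π) * hj

theorem mainTheorem1 (d : ℕ) (hd : 1 < d) (ψ : ℝ → ℝ) (hψ : ψ ∈ PsiClass d) :
    (∀ b : ℕ → ℝ, IsSchoenbergSeq d ψ b → ∀ n, b n = schoenbergCoeff d ψ n) ∧
    ∀ n : ℕ,
      Summable (fun j : ℕ => seriesCoeff (lamOf d) n (j + 1) * circleCoeff ψ (n + 2 * (j + 1))) ∧
      schoenbergCoeff d ψ n =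
        leadFactor (lamOf d) n *
          (circleCoeffStar ψ n - lamOf d *
            ∑' j : ℕ, seriesCoeff (lamOf d) n (j + 1) * circleCoeff ψ (n + 2 * (j + 1))) ∧
      ∀ k : ℕ, d = 2 * k + 1 →
        (∀ μ : ℕ, k < μ → seriesCoeff (lamOf d) n μ = 0) ∧
        schoenbergCoeff d ψ n =
          leadFactor (lamOf d) n *
            (circleCoeffStar ψ n - lamOf d *
              ∑ μ ∈ Finset.Icc 1 k, seriesCoeff (lamOf d) n μ * circleCoeff ψ (n + 2 * μ)) := by
  obtain ⟨K, rfl⟩ : ∃ K, d = K + 1 := ⟨d - 1, by omega⟩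
  have hK : 0 < K := by omega
  have hlam : (0 : ℝ) < (K : ℝ) / 2 := by positivity
  have hl : lamOf (K + 1) = (K : ℝ) / 2 := by simp [lamOf]
  refine ⟨fun b hb n => hb.eq_schoenbergCoeff hK n, fun n => ?_⟩
  rw [hl]
  have h := hasSum_seriesCoeff_mul_circleCoeff hK hψ.1 n
  -- A nonzero prefactor can be divided out, so summability passes to the bare series.
  have hne : -(leadFactor ((K : ℝ) / 2) n * ((K : ℝ) / 2)) ≠ 0 :=
    (neg_neg_of_pos (mul_pos (leadFactor_pos hlam n) hlam)).ne
  have hs := (summable_mul_left_iff hne).mp h.summable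
  have heq : schoenbergCoeff (K + 1) ψ n = leadFactor ((K : ℝ) / 2) n *
      (circleCoeffStar ψ n - (K : ℝ) / 2 * ∑' j : ℕ, seriesCoeff ((K : ℝ) / 2) n (j + 1)
        * circleCoeff ψ (n + 2 * (j + 1))) := by
    have := h.tsum_eq
    rw [tsum_mul_left] at this
    linear_combination -this
  refine ⟨hs, heq, fun k hk => ?_⟩
  have hKk : (K : ℝ) / 2 = k := by
    rw [show K = 2 * k by omega]
    push_cast
    ring
  have hzero : ∀ μ : ℕ, k < μ → seriesCoeff ((K : ℝ) / 2) n μ = 0 := fun μ hμ => by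
    rw [hKk]
    exact seriesCoeff_eq_zero_of_lt (by omega) hμ
  refine ⟨hzero, ?_⟩
  rw [heq, tsum_eq_sum (s := Finset.range k) fun j hj => by
      rw [hzero _ (by simpa [Nat.lt_succ_iff] using hj), zero_mul],
    Finset.range_eq_Ico, Finset.sum_Ico_add'
      (fun μ => seriesCoeff ((K : ℝ) / 2) n μ * circleCoeff ψ (n + 2 * μ)) 0 k 1]
  rfl
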